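/- Let $k$ be a field and let $a_1 < \dots < a_d$ be positive integers with $\gcd(a_1,\dots,a_d)=1$ that generate a numerical semigroup non-redundantly, i.e. no $a_i$ lies in the semigroup (with $0$) generated by the other $a_j$. Let $R = k[[x_1,\dots,x_d]]$, let $A = k[[t^{a_1},\dots,t^{a_d}]] \subseteq k[[t]]$ be the corresponding monomial curve, and let $P$ be its defining ideal, i.e. the (prime) kernel of the homomorphism $R \to A$, $f(x_1,\dots,x_d) \mapsto f(t^{a_1},\dots,t^{a_d})$. Let $P^{(2)} = P^2R_P \cap R = \{x \in R : sx \in P^2 \text{ for some } s \in R\setminus P\}$ denote the second symbolic power of $P$. Suppose that $a_1,\dots,a_d$ contains an arithmetic subsequence of length $5$, whose terms need not be consecutive: there are indices $j_1 < \dots < j_5$ and an integer $r$ with $a_{j_m} = a_{j_1} + (m-1)r$ for $m=1,\dots,5$. Then $P^2 \neq P^{(2)}$. More precisely, for every such choice of indices, $$\det\begin{pmatrix} x_{j_1} & x_{j_2} & x_{j_3}\\ x_{j_2} & x_{j_3} & x_{j_4}\\ x_{j_3} & x_{j_4} & x_{j_5}\end{pmatrix} \in P^{(2)} \setminus P^2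 .$$ -/

import Mathlib

namespace MonomialCurve

noncomputable section

/-- The `n`-th symbolic power `P^(n) = P^n R_P ∩ R` of a prime ideal `P` of `R`. -/
def symbolicPower {R : Type*} [CommRing R] (P : Ideal R) [P.IsPrime] (n : ℕ) : Ideal R :=
  ((P ^ n).map (algebraMap R (Localization.AtPrime P))).comap
    (algebraMap R (Localization.AtPrime P))

/-- `P^(n) = {x ∈ R | ∃ s ∈ R \ P, s x ∈ P^n}`. -/
theorem mem_symbolicPower {R : Type*} [CommRing R] (P : Ideal R) [P.IsPrime] (n : ℕ) (x : R) :
    x ∈ symbolicPower P n ↔ ∃ s : R, s ∉ P ∧ s * x ∈ P ^ n := by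
  rw [symbolicPower, Ideal.mem_comap,
    IsLocalization.algebraMap_mem_map_algebraMap_iff P.primeCompl]
  rfl

theorem hasSubst_X_pow (k : Type*) [Field k] {d : ℕ} (a : Fin d → ℕ) (ha : ∀ i, 0 < a i) :
    MvPowerSeries.HasSubst (fun i => (PowerSeries.X : PowerSeries k) ^ a i) := by
  refine MvPowerSeries.hasSubst_of_constantCoeff_zero fun i => ?_
  change PowerSeries.constantCoeff _ = 0
  simp [(ha i).ne']

/-- The `k`-algebra homomorphism `k[[x_1, …, x_d]] → k[[t]]` given by the substitution
`f(x_1, …, x_d) ↦ f(t ^ a_1, …, t ^ a_d)`. -/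
def substHom (k : Type*) [Field k] {d : ℕ} (a : Fin d → ℕ) (ha : ∀ i, 0 < a i) :
    MvPowerSeries (Fin d) k →ₐ[k] PowerSeries k :=
  MvPowerSeries.substAlgHom (hasSubst_X_pow k a ha)

theorem substHom_X (k : Type*) [Field k] {d : ℕ} (a : Fin d → ℕ) (ha : ∀ i, 0 < a i)
    (i : Fin d) : substHom k a ha (MvPowerSeries.X i) = PowerSeries.X ^ a i := by
  rw [substHom, MvPowerSeries.substAlgHom_X]

/-- The monomial curve `A = k[[t ^ a_1, …, t ^ a_d]] ⊆ k[[t]]`: all power series in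
`t ^ a_1, …, t ^ a_d`. -/
def monomialCurve (k : Type*) [Field k] {d : ℕ} (a : Fin d → ℕ) (ha : ∀ i, 0 < a i) :
    Subalgebra k (PowerSeries k) :=
  (substHom k a ha).range

/-- The defining ideal `P` of `A = k[[t ^ a_1, …, t ^ a_d]]`: the kernel of
`k[[x_1, …, x_d]] → A`, `x_i ↦ t ^ a_i`. -/
def definingIdeal (k : Type*) [Field k] {d : ℕ} (a : Fin d → ℕ) (ha : ∀ i, 0 < a i) :
    Ideal (MvPowerSeries (Fin d) k) :=
  RingHom.ker ((substHom k a ha).rangeRestrict :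
    MvPowerSeries (Fin d) k →ₐ[k] monomialCurve k a ha)

instance definingIdeal_isPrime (k : Type*) [Field k] {d : ℕ} (a : Fin d → ℕ)
    (ha : ∀ i, 0 < a i) : (definingIdeal k a ha).IsPrime :=
  RingHom.ker_isPrime _

/-- The `3 × 3` Hankel matrix of `y_1, …, y_5`. -/
def hankel {R : Type*} (y : Fin 5 → R) : Matrix (Fin 3) (Fin 3) R :=
  !![y 0, y 1, y 2;
     y 1, y 2, y 3;
     y 2, y 3, y 4]

end

end MonomialCurve

/-!
The determinant `D` of the Hankel matrix in `y₀, …, y₄` lies in `P^(2)` because the matrix becomes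
one of rank one under `x_i ↦ t ^ a_i`: its `2 × 2` minors lie in `P`, and the Desnanot-Jacobi
identity writes `y₀ * D` as a quadratic form in these minors, where `y₀ ∉ P`
(`det_hankel_mem_symbolicPower`).

It does not lie in `P ^ 2` because its order as a power series is too small. Since no `a_i` lies in
the semigroup generated by the others, only the linear monomial `x_i` of `f` contributes to the
coefficient of `t ^ a_i` in `f(t ^ a_1, …, t ^ a_d)`. Hence every element of `P` has order at least
two (`two_le_order_of_mem_definingIdeal`), and every element of `P ^ 2` has order at least four. But
`D` is a cubic form in which `y₂ ^ 3` has coefficient `-1` (`order_det_hankel_X_lt_four`).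
-/

namespace MonomialCurve

open MvPowerSeries

theorem mem_definingIdeal {k : Type*} [Field k] {d : ℕ} {a : Fin d → ℕ} {ha : ∀ i, 0 < a i}
    {f : MvPowerSeries (Fin d) k} : f ∈ definingIdeal k a ha ↔ substHom k a ha f = 0 := by
  rw [definingIdeal, RingHom.mem_ker, ← Subtype.coe_inj]
  rfl

theorem coeff_substHom (k : Type*) [Field k] {d : ℕ} (a : Fin d → ℕ) (ha : ∀ i, 0 < a i)
    (f : MvPowerSeries (Fin d) k) (n : ℕ) :
    PowerSeries.coeff n (substHom k a ha f) =
      ∑ᶠ e : Fin d →₀ ℕ, if n = ∑ i, e i * a i then coeff e f else 0 := by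
  rw [substHom, MvPowerSeries.coe_substAlgHom, PowerSeries.coeff,
    MvPowerSeries.coeff_subst (hasSubst_X_pow k a ha)]
  refine finsum_congr fun e => ?_
  have hprod : (e.prod fun i m => ((PowerSeries.X : PowerSeries k) ^ a i) ^ m) =
      PowerSeries.X ^ (∑ i, e i * a i) := by
    rw [Finsupp.prod_fintype _ _ fun i => pow_zero _, ← Finset.prod_pow_eq_pow_sum]
    exact Finset.prod_congr rfl fun i _ => by rw [← pow_mul, mul_comm]
  have hcoeff := PowerSeries.coeff_X_pow (R := k) n (∑ i, e i * a i)
  rw [PowerSeries.coeff] at hcoeff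
  rw [hprod, hcoeff]
  simp

/-- Non-redundancy of the generator `a i` says that it has only one factorization in the
semigroup. -/
theorem eq_single_of_sum_mul_eq {d : ℕ} {a : Fin d → ℕ} (ha : ∀ i, 0 < a i) {i : Fin d}
    (hi : a i ∉ AddSubmonoid.closure (a '' {i}ᶜ)) {e : Fin d →₀ ℕ}
    (he : a i = ∑ l, e l * a l) : e = Finsupp.single i 1 := by
  rw [← Finset.add_sum_erase _ _ (Finset.mem_univ i)] at he
  have hei : e i ≠ 0 := by
    intro h0
    rw [h0, zero_mul, zero_add] at he
    apply hi
    rw [he]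
    refine AddSubmonoid.sum_mem _ fun l hl => ?_
    rw [← smul_eq_mul]
    exact AddSubmonoid.nsmul_mem _ (AddSubmonoid.subset_closure
      (Set.mem_image_of_mem a (Finset.ne_of_mem_erase hl : l ≠ i))) _
  have hle : a i ≤ e i * a i := Nat.le_mul_of_pos_left _ (Nat.pos_of_ne_zero hei)
  have hrest : ∑ l ∈ Finset.univ.erase i, e l * a l = 0 := by omega
  have hone : e i = 1 := Nat.eq_of_mul_eq_mul_right (ha i) (by omega)
  ext l
  rcases eq_or_ne l i with rfl | hl
  · simpa using hone
  · have h := Finset.sum_eq_zero_iff.mp hrest l (Finset.mem_erase.mpr ⟨hl, Finset.mem_univ l⟩)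
    simpa [(ha l).ne', hl.symm] using h

theorem two_le_order_of_mem_definingIdeal {k : Type*} [Field k] {d : ℕ} {a : Fin d → ℕ}
    {ha : ∀ i, 0 < a i} (ha_min : ∀ i, a i ∉ AddSubmonoid.closure (a '' {i}ᶜ))
    {f : MvPowerSeries (Fin d) k} (hf : f ∈ definingIdeal k a ha) : 2 ≤ f.order := by
  rw [mem_definingIdeal] at hf
  -- A monomial whose weight `n` determines it has the coefficient of `t ^ n` in the image of `f`.
  have key : ∀ (n : ℕ) (e₀ : Fin d →₀ ℕ),
      (∀ e : Fin d →₀ ℕ, n = ∑ i, e i * a i ↔ e = e₀) → coeff e₀ f = 0 := by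
    intro n e₀ h
    have hn := coeff_substHom k a ha f n
    rw [hf, map_zero, finsum_eq_single _ e₀ fun e he => if_neg fun h' => he ((h e).mp h'),
      if_pos ((h e₀).mpr rfl)] at hn
    exact hn.symm
  refine MvPowerSeries.le_order fun e he => ?_
  have hdeg : e.degree < 2 := by exact_mod_cast he
  obtain h0 | h1 : e.degree = 0 ∨ e.degree = 1 := by omega
  · rw [Finsupp.degree_eq_zero_iff] at h0
    subst h0
    refine key 0 0 fun e => ⟨fun h => ?_, by rintro rfl; simp⟩
    ext l
    simpa [(ha l).ne'] using Finset.sum_eq_zero_iff.mp h.symm l (Finset.mem_univ l)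
  · obtain ⟨i, rfl⟩ := (Finsupp.sum_eq_one_iff e).mp h1
    refine key (a i) _ fun e => ⟨eq_single_of_sum_mul_eq ha (ha_min i), ?_⟩
    rintro rfl
    simp [Finsupp.single_apply]

theorem four_le_order_of_mem_definingIdeal_sq {k : Type*} [Field k] {d : ℕ} {a : Fin d → ℕ}
    {ha : ∀ i, 0 < a i} (ha_min : ∀ i, a i ∉ AddSubmonoid.closure (a '' {i}ᶜ))
    {f : MvPowerSeries (Fin d) k} (hf : f ∈ definingIdeal k a ha ^ 2) : 4 ≤ f.order := by
  rw [pow_two] at hf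
  induction hf using Submodule.mul_induction_on' with
  | mem_mul_mem g hg h hh =>
    refine le_trans ?_ MvPowerSeries.le_order_mul
    exact add_le_add (two_le_order_of_mem_definingIdeal ha_min hg)
      (two_le_order_of_mem_definingIdeal ha_min hh)
  | add g _ h _ hg hh => exact (le_min hg hh).trans MvPowerSeries.min_order_le_add

theorem det_hankel {R : Type*} [CommRing R] (y : Fin 5 → R) :
    (hankel y).det =
      y 0 * (y 2 * y 4 - y 3 ^ 2) + y 1 * (2 * y 2 * y 3 - y 1 * y 4) - y 2 ^ 3 := by
  rw [Matrix.det_fin_three]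
  simp [hankel]
  ring

theorem order_det_hankel_X_lt_four (k : Type*) [Field k] {d : ℕ} {j : Fin 5 → Fin d}
    (hj : Function.Injective j) :
    (hankel fun m => (X (j m) : MvPowerSeries (Fin d) k)).det.order < 4 := by
  refine lt_of_not_ge fun h => ?_
  have hcoeff := MvPowerSeries.coeff_of_lt_order (d := Finsupp.single (j 2) 3) (lt_of_lt_of_le
    (by rw [Finsupp.degree_single]; norm_num) h)
  have hX : ∀ (m : Fin 5) (f : MvPowerSeries (Fin d) k), m ≠ 2 →
      coeff (Finsupp.single (j 2) 3) (X (j m) * f) = 0 := fun m f hm =>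
    MvPowerSeries.X_dvd_iff.mp (dvd_mul_right _ f) _
      (Finsupp.single_eq_of_ne (hj.ne hm))
  -- Apart from `y₂ ^ 3`, every term of the determinant is divisible by `y₀` or `y₁`.
  rw [det_hankel, map_sub, map_add, hX 0 _ (by decide), hX 1 _ (by decide),
    MvPowerSeries.coeff_X_pow] at hcoeff
  simp at hcoeff

/-- The Desnanot-Jacobi identity for the Hankel matrix and its upper left entry. -/
theorem mul_det_hankel {R : Type*} [CommRing R] (y : Fin 5 → R) :
    y 0 * (hankel y).det =
      (y 0 * y 2 - y 1 * y 1) * (y 0 * y 4 - y 2 * y 2) -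
        (y 0 * y 3 - y 1 * y 2) * (y 0 * y 3 - y 1 * y 2) := by
  rw [det_hankel]
  ring

theorem X_notMem_definingIdeal {k : Type*} [Field k] {d : ℕ} {a : Fin d → ℕ}
    {ha : ∀ i, 0 < a i} (i : Fin d) : X i ∉ definingIdeal k a ha := by
  rw [mem_definingIdeal, substHom_X]
  exact pow_ne_zero _ PowerSeries.X_ne_zero

theorem X_mul_X_sub_mem_definingIdeal {k : Type*} [Field k] {d : ℕ} {a : Fin d → ℕ}
    {ha : ∀ i, 0 < a i} {p q s t : Fin d} (h : a p + a q = a s + a t) :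
    (X p * X q - X s * X t : MvPowerSeries (Fin d) k) ∈ definingIdeal k a ha := by
  simp only [mem_definingIdeal, map_sub, map_mul, substHom_X, ← pow_add, h, sub_self]

theorem det_hankel_mem_symbolicPower (k : Type*) [Field k] {d : ℕ} (a : Fin d → ℕ)
    (ha : ∀ i, 0 < a i) (j : Fin 5 → Fin d) (r : ℕ)
    (h_arith : ∀ m : Fin 5, a (j m) = a (j 0) + (m : ℕ) * r) :
    (hankel fun m => (X (j m) : MvPowerSeries (Fin d) k)).det ∈
      symbolicPower (definingIdeal k a ha) 2 := by
  have minor_mem : ∀ p q s t : Fin 5, (p : ℕ) + q = s + t →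
      (X (j p) * X (j q) - X (j s) * X (j t) : MvPowerSeries (Fin d) k) ∈
        definingIdeal k a ha := by
    intro p q s t h
    apply X_mul_X_sub_mem_definingIdeal
    rw [h_arith p, h_arith q, h_arith s, h_arith t]
    linear_combination r * h
  rw [mem_symbolicPower]
  refine ⟨X (j 0), X_notMem_definingIdeal _, ?_⟩
  rw [mul_det_hankel fun m => (X (j m) : MvPowerSeries (Fin d) k), pow_two]
  exact sub_mem
    (Ideal.mul_mem_mul (minor_mem 0 2 1 1 rfl) (minor_mem 0 4 2 2 rfl))
    (Ideal.mul_mem_mul (minor_mem 0 3 1 2 rfl) (minor_mem 0 3 1 2 rfl))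

end MonomialCurve

theorem mainTheorem3 (k : Type*) [Field k] (d : ℕ) (a : Fin d → ℕ)
    (ha_pos : ∀ i, 0 < a i) (ha_mono : StrictMono a)
    (ha_gcd : Finset.univ.gcd a = 1)
    -- the `a i` generate their semigroup non-redundantly
    (ha_min : ∀ i, a i ∉ AddSubmonoid.closure (a '' {i}ᶜ))
    -- `a (j 0), …, a (j 4)` is an arithmetic subsequence of length five
    (j : Fin 5 → Fin d) (hj : StrictMono j) (r : ℕ)
    (h_arith : ∀ m : Fin 5, a (j m) = a (j 0) + (m : ℕ) * r) :
    MonomialCurve.definingIdeal k a ha_pos ^ 2 ≠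
        MonomialCurve.symbolicPower (MonomialCurve.definingIdeal k a ha_pos) 2 ∧
      (MonomialCurve.hankel fun m => (MvPowerSeries.X (j m) : MvPowerSeries (Fin d) k)).det ∈
        MonomialCurve.symbolicPower (MonomialCurve.definingIdeal k a ha_pos) 2 ∧
      (MonomialCurve.hankel fun m => (MvPowerSeries.X (j m) : MvPowerSeries (Fin d) k)).det ∉
        MonomialCurve.definingIdeal k a ha_pos ^ 2 := by
  have mem := MonomialCurve.det_hankel_mem_symbolicPower k a ha_pos j r h_arith
  have notMem : (MonomialCurve.hankel fun m =>
      (MvPowerSeries.X (j m) : MvPowerSeries (Fin d) k)).det ∉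
        MonomialCurve.definingIdeal k a ha_pos ^ 2 := fun h =>
    (MonomialCurve.order_det_hankel_X_lt_four k hj.injective).not_ge
      (MonomialCurve.four_le_order_of_mem_definingIdeal_sq ha_min h)
  exact ⟨fun h => notMem (h ▸ mem), mem, notMem⟩
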